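/- Let $\mathcal P_2(\mathbb R^d)$ be the set of Borel probability measures on $\mathbb R^d$ with finite second moment, and let $W_2$ be the $L^2$-Wasserstein distance, $W_2^2(\mu,\nu)=\inf_\gamma\int|x-y|^2\,\mathrm d\gamma(x,y)$, where $\gamma$ ranges over the couplings of $\mu$ and $\nu$. For $t>1$ and $\nu_0,\nu_1,\mu\in\mathcal P_2(\mathbb R^d)$ put $$\mathcal F_t(\nu_0,\nu_1;\mu)=\frac{W_2^2(\mu,\nu_1)}{2(t-1)}-\frac{W_2^2(\mu,\nu_0)}{2t}.$$ (Stability of the extrapolation.) There is a real polynomial $P$ in four variables, independent of the dimension and of all the data, which is strictly positive on $[0,\infty)^4$ and has the following property. Let $d\ge 0$, $t,s>1$ and $\nu_0,\nu_1,\tilde\nu_0,\tilde\nu_1\in\mathcal P_2(\mathbb R^d)$; let $\nu_t$ be a minimizer of $\mathcal F_t(\nu_0,\nu_1;\cdot)$ over $\mathcal P_2(\mathbb R^d)$ and let $\tilde\nu_s$ be a minimizer of $\mathcal F_s(\tilde\nu_0,\tilde\nu_1;\cdot)$ over $\mathcal P_2(\mathbb R^d)$. Then $$W_2^2(\nu_t,\tilde\nu_s)\le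 C\left(|t-s|^2+W_2(\nu_0,\tilde\nu_0)+W_2(\nu_1,\tilde\nu_1)\right),$$ where $$C=P\bigl(\max(t,s),\,W_2(\nu_0,\tilde\nu_0),\,W_2(\nu_1,\tilde\nu_1),\,W_2(\nu_0,\nu_1)\bigr)>0.$$ -/

import Mathlib

open MeasureTheory
open scoped ENNReal

namespace MetricExtrapolation

/-- The set of Borel probability measures on `ℝ^d` (with its Euclidean norm) that have finite
second moment. -/
def P2 (d : ℕ) : Set (Measure (EuclideanSpace ℝ (Fin d))) :=
  {μ | IsProbabilityMeasure μ ∧ ∫⁻ x, ‖x‖ₑ ^ 2 ∂μ < ∞}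

/-- The couplings of `μ` and `ν`: measures on the product with marginals `μ` and `ν`. For
`μ, ν` in `P2 d` these are automatically probability measures with finite second moment. -/
def couplings {d : ℕ} (μ ν : Measure (EuclideanSpace ℝ (Fin d))) :
    Set (Measure (EuclideanSpace ℝ (Fin d) × EuclideanSpace ℝ (Fin d))) :=
  {γ | γ.map Prod.fst = μ ∧ γ.map Prod.snd = ν}

/-- The optimal quadratic transport cost `inf_γ ∫ |x - y|² dγ(x, y)`, with values in `[0, ∞]`. -/
noncomputable def transportCost {d : ℕ} (μ ν : Measure (EuclideanSpace ℝ (Fin d))) : ℝ≥0∞ :=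
  ⨅ γ ∈ couplings μ ν, ∫⁻ p, ‖p.1 - p.2‖ₑ ^ 2 ∂γ

/-- The transport cost between measures of `P2 d` is finite, so that the conversion to a real
number in the definition of `W2` loses nothing there. -/
theorem transportCost_lt_top {d : ℕ} {μ ν : Measure (EuclideanSpace ℝ (Fin d))}
    (hμ : μ ∈ P2 d) (hν : ν ∈ P2 d) : transportCost μ ν < ∞ := by
  obtain ⟨hμ1, hμ2⟩ := hμ
  obtain ⟨hν1, hν2⟩ := hν
  have hmem : μ.prod ν ∈ couplings μ ν := by
    constructor
    · simp [Measure.map_fst_prod]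
    · simp [Measure.map_snd_prod]
  refine lt_of_le_of_lt (iInf₂_le _ hmem) ?_
  have hpt : ∀ p : EuclideanSpace ℝ (Fin d) × EuclideanSpace ℝ (Fin d),
      ‖p.1 - p.2‖ₑ ^ 2 ≤ 2 * (‖p.1‖ₑ ^ 2 + ‖p.2‖ₑ ^ 2) := by
    intro p
    calc ‖p.1 - p.2‖ₑ ^ 2 ≤ (‖p.1‖ₑ + ‖p.2‖ₑ) ^ 2 := by gcongr; exact enorm_sub_le
      _ ≤ 2 * (‖p.1‖ₑ ^ 2 + ‖p.2‖ₑ ^ 2) := by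
        have h := ENNReal.rpow_add_le_mul_rpow_add_rpow ‖p.1‖ₑ ‖p.2‖ₑ
          (one_le_two : (1 : ℝ) ≤ 2)
        rw [show (2 : ℝ) - 1 = 1 by norm_num, ENNReal.rpow_one] at h
        simpa only [ENNReal.rpow_two] using h
  refine lt_of_le_of_lt (lintegral_mono hpt) ?_
  rw [lintegral_const_mul _ (by fun_prop), lintegral_add_left (by fun_prop)]
  have h1 : ∫⁻ p, ‖p.1‖ₑ ^ 2 ∂(μ.prod ν) = ∫⁻ x, ‖x‖ₑ ^ 2 ∂μ := by
    rw [← hmem.1, lintegral_map (by fun_prop) measurable_fst, hmem.1]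
  have h2 : ∫⁻ p, ‖p.2‖ₑ ^ 2 ∂(μ.prod ν) = ∫⁻ x, ‖x‖ₑ ^ 2 ∂ν := by
    rw [← hmem.2, lintegral_map (by fun_prop) measurable_snd, hmem.2]
  rw [h1, h2]
  exact ENNReal.mul_lt_top (by simp) (ENNReal.add_lt_top.2 ⟨hμ2, hν2⟩)

/-- The `L²`-Wasserstein distance (meant for measures of `P2 d`). -/
noncomputable def W2 {d : ℕ} (μ ν : Measure (EuclideanSpace ℝ (Fin d))) : ℝ :=
  Real.sqrt (transportCost μ ν).toReal

/-- The functional `F_t(ν₀, ν₁; μ) = W₂²(μ, ν₁) / (2 (t - 1)) - W₂²(μ, ν₀) / (2 t)`. -/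
noncomputable def F {d : ℕ} (t : ℝ) (ν₀ ν₁ μ : Measure (EuclideanSpace ℝ (Fin d))) : ℝ :=
  W2 μ ν₁ ^ 2 / (2 * (t - 1)) - W2 μ ν₀ ^ 2 / (2 * t)

/-- `ν` minimizes `F_t(ν₀, ν₁; ·)` over the measures of `P2 d`. -/
def IsMinimizer {d : ℕ} (t : ℝ) (ν₀ ν₁ ν : Measure (EuclideanSpace ℝ (Fin d))) : Prop :=
  ν ∈ P2 d ∧ ∀ μ ∈ P2 d, F t ν₀ ν₁ ν ≤ F t ν₀ ν₁ μ

end MetricExtrapolation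

/-! Multiplied by 2t(t-1), the functional becomes G_t(μ) = t W₂²(μ,ν₁) - (t-1) W₂²(μ,ν₀). Along an
interpolation of two measures coupled through ν₁, the first squared distance is convex with modulus
K, the mean squared displacement, while the second is at worst semiconcave with the same K. The
balance t - (t-1) = 1 makes G_t strongly convex, so a minimizer ν satisfies G_t(ν) + W₂²(μ,ν) ≤
G_t(μ) for every competitor (`IsMinimizer.add_W2_sq_le`).

Each minimizer is then tested against the other and the two inequalities are added. What remains are
differences of squared distances, controlled by the triangle inequality and the a priori bound
`IsMinimizer.W2_le`; Young's inequality absorbs the term in |t - s|. Near-optimal couplings suffice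
throughout, so existence of optimal plans is never needed. -/

namespace MetricExtrapolation

open ProbabilityTheory

/-- A coupling of the law of `f` with a second measure lifts along `f`. -/
theorem exists_lift {A B C : Type*} [MeasurableSpace A] [MeasurableSpace B] [MeasurableSpace C]
    [StandardBorelSpace C] [Nonempty C] (π : Measure A) [IsProbabilityMeasure π] {f : A → B}
    (hf : Measurable f) (σ : Measure (B × C)) (hσ : σ.map Prod.fst = π.map f) :
    ∃ τ : Measure (A × C), τ.map Prod.fst = π ∧ τ.map (Prod.map f id) = σ := by
  have hprob : IsProbabilityMeasure (σ.map Prod.fst) := by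
    rw [hσ]; exact Measure.isProbabilityMeasure_map hf.aemeasurable
  have hσp : IsProbabilityMeasure σ :=
    Measure.isProbabilityMeasure_of_map Prod.fst
  -- Over `a`, the new coordinate follows the conditional law of `σ` given first coordinate `f a`.
  refine ⟨π ⊗ₘ (σ.condKernel.comap f hf), Measure.fst_compProd π _, ?_⟩
  have hdis : σ.fst ⊗ₘ σ.condKernel = σ := Measure.disintegrate σ σ.condKernel
  have hfst : σ.fst = π.map f := hσ
  refine Eq.trans ?_ hdis
  ext s hs
  have hm : Measurable (Prod.map f (id : C → C)) := hf.prodMap measurable_id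
  rw [Measure.map_apply hm hs, Measure.compProd_apply (hm hs), Measure.compProd_apply hs, hfst,
    lintegral_map (Kernel.measurable_kernel_prodMk_left hs) hf]
  rfl

/-! ### Couplings as random variables, and the metric properties of `W2` -/

variable {d : ℕ}

theorem memLp_of_mem_P2 {Ω : Type*} [MeasurableSpace Ω] {τ : Measure Ω}
    {X : Ω → EuclideanSpace ℝ (Fin d)} (hX : Measurable X) (h : τ.map X ∈ P2 d) :
    MemLp X 2 τ := by
  refine ⟨hX.aestronglyMeasurable, ?_⟩
  rw [eLpNorm_lt_top_iff_lintegral_rpow_enorm_lt_top (by simp) (by simp)]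
  have h2 := h.2
  rw [lintegral_map (by fun_prop) hX] at h2
  simpa using h2

theorem map_mem_P2 {Ω : Type*} [MeasurableSpace Ω] {τ : Measure Ω} [IsProbabilityMeasure τ]
    {X : Ω → EuclideanSpace ℝ (Fin d)} (hX : Measurable X) (h : MemLp X 2 τ) :
    τ.map X ∈ P2 d := by
  refine ⟨Measure.isProbabilityMeasure_map hX.aemeasurable, ?_⟩
  have h2 := h.2
  rw [eLpNorm_lt_top_iff_lintegral_rpow_enorm_lt_top (by simp) (by simp)] at h2
  rw [lintegral_map (by fun_prop) hX]
  simpa using h2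

theorem integrable_norm_sq {Ω : Type*} [MeasurableSpace Ω] {τ : Measure Ω}
    {X : Ω → EuclideanSpace ℝ (Fin d)} (h : MemLp X 2 τ) :
    Integrable (fun ω => ‖X ω‖ ^ 2) τ :=
  MemLp.integrable_norm_pow (p := 2) (by exact_mod_cast h) two_ne_zero

theorem lintegral_enorm_sq {Ω : Type*} [MeasurableSpace Ω] {τ : Measure Ω}
    {X : Ω → EuclideanSpace ℝ (Fin d)} (h : MemLp X 2 τ) :
    ∫⁻ ω, ‖X ω‖ₑ ^ 2 ∂τ = ENNReal.ofReal (∫ ω, ‖X ω‖ ^ 2 ∂τ) := by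
  rw [ofReal_integral_eq_lintegral_ofReal (integrable_norm_sq h)
    (ae_of_all _ fun _ => by positivity)]
  refine lintegral_congr fun ω => ?_
  rw [ENNReal.ofReal_pow (norm_nonneg _), ofReal_norm]

theorem W2_nonneg (μ ν : Measure (EuclideanSpace ℝ (Fin d))) : 0 ≤ W2 μ ν := Real.sqrt_nonneg _

theorem W2_sq (μ ν : Measure (EuclideanSpace ℝ (Fin d))) :
    W2 μ ν ^ 2 = (transportCost μ ν).toReal := Real.sq_sqrt ENNReal.toReal_nonneg

theorem W2_map_sq_le {Ω : Type*} [MeasurableSpace Ω] {τ : Measure Ω}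
    {X Y : Ω → EuclideanSpace ℝ (Fin d)} (hX : Measurable X) (hY : Measurable Y)
    (hX2 : MemLp X 2 τ) (hY2 : MemLp Y 2 τ) :
    W2 (τ.map X) (τ.map Y) ^ 2 ≤ ∫ ω, ‖X ω - Y ω‖ ^ 2 ∂τ := by
  rw [W2_sq]
  refine ENNReal.toReal_le_of_le_ofReal (integral_nonneg fun _ => by positivity) ?_
  have hXY : Measurable fun ω => (X ω, Y ω) := hX.prodMk hY
  have hmem : τ.map (fun ω => (X ω, Y ω)) ∈ couplings (τ.map X) (τ.map Y) :=
    ⟨Measure.map_map measurable_fst hXY, Measure.map_map measurable_snd hXY⟩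
  refine (iInf₂_le _ hmem).trans ?_
  rw [lintegral_map (by fun_prop) hXY]
  exact (lintegral_enorm_sq (hX2.sub hY2)).le

theorem exists_coupling_lt {μ ν : Measure (EuclideanSpace ℝ (Fin d))} (hμ : μ ∈ P2 d)
    (hν : ν ∈ P2 d) {c : ℝ} (hc : W2 μ ν ^ 2 < c) :
    ∃ γ ∈ couplings μ ν, IsProbabilityMeasure γ ∧ ∫ p, ‖p.1 - p.2‖ ^ 2 ∂γ < c := by
  have hlt : transportCost μ ν < ENNReal.ofReal c := by
    rw [W2_sq] at hc
    exact (ENNReal.lt_ofReal_iff_toReal_lt (transportCost_lt_top hμ hν).ne).2 hc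
  simp only [transportCost, iInf_lt_iff] at hlt
  obtain ⟨γ, hγ, hlt⟩ := hlt
  have hp : IsProbabilityMeasure (γ.map Prod.fst) := by rw [hγ.1]; exact hμ.1
  refine ⟨γ, hγ, Measure.isProbabilityMeasure_of_map Prod.fst, ?_⟩
  have h1 : MemLp (fun p => p.1) 2 γ :=
    memLp_of_mem_P2 measurable_fst (by rw [← hγ.1] at hμ; exact hμ)
  have h2 : MemLp (fun p => p.2) 2 γ :=
    memLp_of_mem_P2 measurable_snd (by rw [← hγ.2] at hν; exact hν)
  have h3 := lintegral_enorm_sq (h1.sub h2)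
  simp only [Pi.sub_apply] at h3
  rw [h3] at hlt
  exact (ENNReal.ofReal_lt_ofReal_iff_of_nonneg (integral_nonneg fun _ => by positivity)).1 hlt

/-- Every near-optimal coupling of the law of `f` with `ν` is realised by adding a further
coordinate to the underlying probability space. -/
theorem exists_near_optimal_lift {Ω : Type*} [MeasurableSpace Ω] (π : Measure Ω)
    [IsProbabilityMeasure π] {f : Ω → EuclideanSpace ℝ (Fin d)} (hf : Measurable f)
    {ν : Measure (EuclideanSpace ℝ (Fin d))} (hfP : π.map f ∈ P2 d) (hν : ν ∈ P2 d) {c : ℝ}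
    (hc : W2 (π.map f) ν ^ 2 < c) :
    ∃ τ : Measure (Ω × EuclideanSpace ℝ (Fin d)), IsProbabilityMeasure τ ∧
      τ.map Prod.fst = π ∧ τ.map Prod.snd = ν ∧ ∫ p, ‖f p.1 - p.2‖ ^ 2 ∂τ < c := by
  obtain ⟨γ, hγ, -, hγc⟩ := exists_coupling_lt hfP hν hc
  obtain ⟨τ, h1, h2⟩ := exists_lift π hf γ hγ.1
  have hp : IsProbabilityMeasure (τ.map Prod.fst) := by rw [h1]; infer_instance
  have hm : Measurable (Prod.map f (id : EuclideanSpace ℝ (Fin d) → _)) :=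
    hf.prodMap measurable_id
  refine ⟨τ, Measure.isProbabilityMeasure_of_map Prod.fst, h1, ?_, ?_⟩
  · rw [← hγ.2, ← h2, Measure.map_map measurable_snd hm]
    rfl
  · rw [← h2, integral_map hm.aemeasurable
      (by fun_prop : Measurable _).aestronglyMeasurable] at hγc
    exact hγc

theorem W2_comm (μ ν : Measure (EuclideanSpace ℝ (Fin d))) : W2 μ ν = W2 ν μ := by
  have key : ∀ μ ν : Measure (EuclideanSpace ℝ (Fin d)),
      transportCost μ ν ≤ transportCost ν μ := by
    intro μ ν
    refine le_iInf₂ fun γ hγ => ?_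
    have hmem : γ.map Prod.swap ∈ couplings μ ν := by
      constructor
      · rw [Measure.map_map measurable_fst measurable_swap]; exact hγ.2
      · rw [Measure.map_map measurable_snd measurable_swap]; exact hγ.1
    refine (iInf₂_le _ hmem).trans ?_
    rw [lintegral_map (by fun_prop) measurable_swap]
    refine lintegral_mono fun p => ?_
    simp only [Prod.fst_swap, Prod.snd_swap]
    rw [← enorm_neg, neg_sub]
  rw [W2, W2, le_antisymm (key μ ν) (key ν μ)]

theorem W2_self {μ : Measure (EuclideanSpace ℝ (Fin d))} (hμ : μ ∈ P2 d) : W2 μ μ = 0 := by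
  have h : MemLp id 2 μ := memLp_of_mem_P2 measurable_id (by rwa [Measure.map_id])
  have := W2_map_sq_le measurable_id measurable_id h h
  simp only [Measure.map_id, sub_self, norm_zero] at this
  have h0 := W2_nonneg μ μ
  simp at this
  nlinarith

/-- This replaces Minkowski's inequality in L²: once integrated against second moments at most a²
and b², the right side is at most (a + b)². -/
theorem norm_sub_sq_le_weighted {E : Type*} [SeminormedAddCommGroup E] (x y z : E)
    {a b : ℝ} (ha : 0 < a) (hb : 0 < b) :
    ‖x - z‖ ^ 2 ≤ (1 + b / a) * ‖x - y‖ ^ 2 + (1 + a / b) * ‖y - z‖ ^ 2 := by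
  have h := norm_sub_le_norm_sub_add_norm_sub x y z
  have h1 : ‖x - z‖ ^ 2 ≤ (‖x - y‖ + ‖y - z‖) ^ 2 := by gcongr
  refine h1.trans ?_
  have : (1 + b / a) * ‖x - y‖ ^ 2 + (1 + a / b) * ‖y - z‖ ^ 2 - (‖x - y‖ + ‖y - z‖) ^ 2
      = (b * ‖x - y‖ - a * ‖y - z‖) ^ 2 / (a * b) := by
    field_simp
    ring
  have : 0 ≤ (b * ‖x - y‖ - a * ‖y - z‖) ^ 2 / (a * b) := by positivity
  linarith

/-- Two near-optimal couplings are glued along their common marginal ν. -/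
theorem W2_triangle {μ ν ρ : Measure (EuclideanSpace ℝ (Fin d))} (hμ : μ ∈ P2 d) (hν : ν ∈ P2 d)
    (hρ : ρ ∈ P2 d) : W2 μ ρ ≤ W2 μ ν + W2 ν ρ := by
  refine le_of_forall_pos_le_add fun ε hε => ?_
  -- The slack also keeps both weights positive when a distance vanishes.
  set a := W2 μ ν + ε / 2 with ha
  set b := W2 ν ρ + ε / 2 with hb
  have ha0 : 0 < a := by have := W2_nonneg μ ν; positivity
  have hb0 : 0 < b := by have := W2_nonneg ν ρ; positivity
  obtain ⟨γ, hγ, hγp, hγc⟩ := exists_coupling_lt hμ hν (c := a ^ 2)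
    (by have := W2_nonneg μ ν; nlinarith)
  obtain ⟨τ, hτp, h1, h2, hτc⟩ := exists_near_optimal_lift γ (f := Prod.snd) measurable_snd
    (by rw [hγ.2]; exact hν) hρ (c := b ^ 2)
    (by rw [hγ.2]; have := W2_nonneg ν ρ; nlinarith)
  have e1 : τ.map (fun p => p.1.1) = μ := by
    rw [← hγ.1, ← h1, Measure.map_map measurable_fst measurable_fst]; rfl
  have e2 : τ.map (fun p => p.1.2) = ν := by
    rw [← hγ.2, ← h1, Measure.map_map measurable_snd measurable_fst]; rfl
  have m1 : MemLp (fun p => p.1.1) 2 τ := memLp_of_mem_P2 (by fun_prop) (by rwa [e1])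
  have m2 : MemLp (fun p => p.1.2) 2 τ := memLp_of_mem_P2 (by fun_prop) (by rwa [e2])
  have m3 : MemLp (fun p => p.2) 2 τ := memLp_of_mem_P2 measurable_snd (by rw [h2]; exact hρ)
  have hle := W2_map_sq_le (by fun_prop) measurable_snd m1 m3
  rw [e1, h2] at hle
  have i12 := integrable_norm_sq (m1.sub m2)
  have i23 := integrable_norm_sq (m2.sub m3)
  have i13 := integrable_norm_sq (m1.sub m3)
  simp only [Pi.sub_apply] at i12 i23 i13
  rw [← h1, integral_map measurable_fst.aemeasurable
      (by fun_prop : Measurable _).aestronglyMeasurable] at hγc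
  have hint := integral_mono i13 ((i12.const_mul (1 + b / a)).add (i23.const_mul (1 + a / b)))
    fun p => norm_sub_sq_le_weighted p.1.1 p.1.2 p.2 ha0 hb0
  simp only [Pi.add_apply] at hint
  rw [integral_add (i12.const_mul _) (i23.const_mul _), integral_const_mul,
    integral_const_mul] at hint
  have hfin : (1 + b / a) * a ^ 2 + (1 + a / b) * b ^ 2 = (a + b) ^ 2 := by
    field_simp
    ring
  have hA : (1 + b / a) * ∫ p, ‖p.1.1 - p.1.2‖ ^ 2 ∂τ ≤ (1 + b / a) * a ^ 2 := by gcongr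
  have hB : (1 + a / b) * ∫ p, ‖p.1.2 - p.2‖ ^ 2 ∂τ ≤ (1 + a / b) * b ^ 2 := by gcongr
  have : W2 μ ρ ^ 2 ≤ (a + b) ^ 2 := by linarith
  have := (pow_le_pow_iff_left₀ (W2_nonneg μ ρ) (by positivity) two_ne_zero).1 this
  linarith

/-! ### Convexity and semiconcavity along interpolations -/

/-- Equality matters: the identity serves as an upper bound for the distance to ν₁ and as a lower
bound for the distance to ν₀. -/
theorem norm_interpolation_sub_sq {E : Type*} [NormedAddCommGroup E] [InnerProductSpace ℝ E]
    (x y z : E) (r : ℝ) :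
    ‖(1 - r) • x + r • y - z‖ ^ 2 =
      (1 - r) * ‖x - z‖ ^ 2 + r * ‖y - z‖ ^ 2 - r * (1 - r) * ‖x - y‖ ^ 2 := by
  have e1 : (1 - r) • x + r • y - z = (1 - r) • (x - z) + r • (y - z) := by module
  have e2 : x - y = (x - z) - (y - z) := by abel
  rw [e1, e2, norm_add_sq_real, norm_sub_sq_real (x - z), norm_smul, norm_smul,
    real_inner_smul_left, real_inner_smul_right, mul_pow, mul_pow, Real.norm_eq_abs,
    Real.norm_eq_abs, sq_abs, sq_abs]
  ring

theorem integral_norm_interpolation_sub_sq {Ω : Type*} [MeasurableSpace Ω] {τ : Measure Ω}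
    {X Y Z : Ω → EuclideanSpace ℝ (Fin d)} (hX : MemLp X 2 τ) (hY : MemLp Y 2 τ)
    (hZ : MemLp Z 2 τ) (r : ℝ) :
    ∫ ω, ‖(1 - r) • X ω + r • Y ω - Z ω‖ ^ 2 ∂τ =
      (1 - r) * ∫ ω, ‖X ω - Z ω‖ ^ 2 ∂τ + r * ∫ ω, ‖Y ω - Z ω‖ ^ 2 ∂τ
        - r * (1 - r) * ∫ ω, ‖X ω - Y ω‖ ^ 2 ∂τ := by
  have i1 := integrable_norm_sq (hX.sub hZ)
  have i2 := integrable_norm_sq (hY.sub hZ)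
  have i3 := integrable_norm_sq (hX.sub hY)
  simp only [Pi.sub_apply] at i1 i2 i3
  simp only [norm_interpolation_sub_sq]
  have i12 : Integrable (fun ω => (1 - r) * ‖X ω - Z ω‖ ^ 2 + r * ‖Y ω - Z ω‖ ^ 2) τ :=
    (i1.const_mul _).add (i2.const_mul _)
  rw [integral_sub i12 (i3.const_mul _),
    integral_add (i1.const_mul _) (i2.const_mul _), integral_const_mul, integral_const_mul,
    integral_const_mul]

/-- Semiconcavity of the squared distance along an arbitrary interpolation. -/
theorem le_W2_interpolation_sq {Ω : Type*} [MeasurableSpace Ω] (π : Measure Ω)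
    [IsProbabilityMeasure π] {X Y : Ω → EuclideanSpace ℝ (Fin d)} (hX : Measurable X)
    (hY : Measurable Y) (hX2 : MemLp X 2 π) (hY2 : MemLp Y 2 π)
    {ν : Measure (EuclideanSpace ℝ (Fin d))} (hν : ν ∈ P2 d) {r : ℝ} (hr0 : 0 ≤ r) (hr1 : r ≤ 1) :
    (1 - r) * W2 (π.map X) ν ^ 2 + r * W2 (π.map Y) ν ^ 2
        - r * (1 - r) * ∫ ω, ‖X ω - Y ω‖ ^ 2 ∂π ≤
      W2 (π.map fun ω => (1 - r) • X ω + r • Y ω) ν ^ 2 := by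
  refine le_of_forall_gt_imp_ge_of_dense fun c hc => ?_
  have hI : Measurable fun ω => (1 - r) • X ω + r • Y ω := by fun_prop
  have hI2 : MemLp (fun ω => (1 - r) • X ω + r • Y ω) 2 π :=
    (hX2.const_smul (1 - r)).add (hY2.const_smul r)
  -- The lift keeps `X` and `Y`, so one plan for the interpolated law also couples both endpoint
  -- laws with ν.
  obtain ⟨τ, hτp, h1, h2, hτc⟩ := exists_near_optimal_lift π hI
    (map_mem_P2 hI hI2) hν hc
  have mX : Measurable fun p : Ω × EuclideanSpace ℝ (Fin d) => X p.1 := hX.comp measurable_fst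
  have mY : Measurable fun p : Ω × EuclideanSpace ℝ (Fin d) => Y p.1 := hY.comp measurable_fst
  have eX : τ.map (fun p => X p.1) = π.map X := by
    rw [← h1, Measure.map_map hX measurable_fst]; rfl
  have eY : τ.map (fun p => Y p.1) = π.map Y := by
    rw [← h1, Measure.map_map hY measurable_fst]; rfl
  have lX : MemLp (fun p => X p.1) 2 τ := memLp_of_mem_P2 mX (by rw [eX]; exact map_mem_P2 hX hX2)
  have lY : MemLp (fun p => Y p.1) 2 τ := memLp_of_mem_P2 mY (by rw [eY]; exact map_mem_P2 hY hY2)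
  have lZ : MemLp (fun p => p.2) 2 τ := memLp_of_mem_P2 measurable_snd (by rw [h2]; exact hν)
  have hXZ := W2_map_sq_le mX measurable_snd lX lZ
  have hYZ := W2_map_sq_le mY measurable_snd lY lZ
  rw [eX, h2] at hXZ
  rw [eY, h2] at hYZ
  have hsm : AEStronglyMeasurable (fun ω => ‖X ω - Y ω‖ ^ 2) (τ.map Prod.fst) :=
    (by fun_prop : Measurable fun ω => ‖X ω - Y ω‖ ^ 2).aestronglyMeasurable
  have hK : ∫ ω, ‖X ω - Y ω‖ ^ 2 ∂π = ∫ p, ‖X p.1 - Y p.1‖ ^ 2 ∂τ := by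
    have := integral_map measurable_fst.aemeasurable hsm
    rwa [h1] at this
  rw [integral_norm_interpolation_sub_sq lX lY lZ r] at hτc
  rw [hK]
  have := mul_le_mul_of_nonneg_left hXZ (sub_nonneg.2 hr1)
  have := mul_le_mul_of_nonneg_left hYZ hr0
  linarith

/-! ### Growth and a priori bounds at a minimizer -/

/-- The functional `F t ν₀ ν₁`, multiplied by `2 * t * (t - 1)`. -/
theorem two_mul_F {t : ℝ} (ht : 1 < t) (ν₀ ν₁ μ : Measure (EuclideanSpace ℝ (Fin d))) :
    2 * t * (t - 1) * F t ν₀ ν₁ μ = t * W2 μ ν₁ ^ 2 - (t - 1) * W2 μ ν₀ ^ 2 := by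
  have : t - 1 ≠ 0 := by linarith
  have : t ≠ 0 := by linarith
  rw [F]
  field_simp

theorem IsMinimizer.le {t : ℝ} (ht : 1 < t) {ν₀ ν₁ ν μ : Measure (EuclideanSpace ℝ (Fin d))}
    (h : IsMinimizer t ν₀ ν₁ ν) (hμ : μ ∈ P2 d) :
    t * W2 ν ν₁ ^ 2 - (t - 1) * W2 ν ν₀ ^ 2 ≤ t * W2 μ ν₁ ^ 2 - (t - 1) * W2 μ ν₀ ^ 2 := by
  rw [← two_mul_F ht, ← two_mul_F ht]
  have h1 : 0 < t - 1 := by linarith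
  have h0 : 0 < t := by linarith
  exact mul_le_mul_of_nonneg_left (h.2 μ hμ) (by positivity)

/-- Strong convexity of `F t ν₀ ν₁` along generalized geodesics with base `ν₁`, at a minimizer. -/
theorem IsMinimizer.interpolation_le {t : ℝ} (ht : 1 < t)
    {ν₀ ν₁ ν μ : Measure (EuclideanSpace ℝ (Fin d))}
    (h : IsMinimizer t ν₀ ν₁ ν) (h₀ : ν₀ ∈ P2 d) (h₁ : ν₁ ∈ P2 d) (hμ : μ ∈ P2 d)
    {r : ℝ} (hr0 : 0 < r) (hr1 : r < 1) :
    t * W2 ν ν₁ ^ 2 - (t - 1) * W2 ν ν₀ ^ 2 + (1 - r) * W2 μ ν ^ 2 ≤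
      t * W2 μ ν₁ ^ 2 - (t - 1) * W2 μ ν₀ ^ 2 := by
  have hν := h.1
  have ht0 : 0 < t := by linarith
  suffices hs : ∀ ε > 0, r * (t * W2 ν ν₁ ^ 2 - (t - 1) * W2 ν ν₀ ^ 2 + (1 - r) * W2 μ ν ^ 2) ≤
      r * (t * W2 μ ν₁ ^ 2 - (t - 1) * W2 μ ν₀ ^ 2) + ε from
    le_of_mul_le_mul_left (le_of_forall_pos_le_add hs) hr0
  intro ε hε
  set δ := ε / t with hδ
  have hδ0 : 0 < δ := by positivity
  -- Gluing at ν₁ makes the pairs (ν, ν₁) and (μ, ν₁) near-optimal at once; the pair (ν, μ) need not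
  -- be.
  obtain ⟨γ, hγ, hγp, hγc⟩ := exists_coupling_lt hν h₁ (c := W2 ν ν₁ ^ 2 + δ) (by linarith)
  obtain ⟨π, hπp, hπ1, hπ2, hπc⟩ := exists_near_optimal_lift γ (f := Prod.snd) measurable_snd
    (by rw [hγ.2]; exact h₁) hμ (c := W2 μ ν₁ ^ 2 + δ)
    (by rw [hγ.2, W2_comm ν₁ μ]; linarith)
  have e1 : π.map (fun p => p.1.1) = ν := by
    rw [← hγ.1, ← hπ1, Measure.map_map measurable_fst measurable_fst]; rfl
  have e3 : π.map (fun p => p.1.2) = ν₁ := by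
    rw [← hγ.2, ← hπ1, Measure.map_map measurable_snd measurable_fst]; rfl
  have l1 : MemLp (fun p => p.1.1) 2 π := memLp_of_mem_P2 (by fun_prop) (by rwa [e1])
  have l3 : MemLp (fun p => p.1.2) 2 π := memLp_of_mem_P2 (by fun_prop) (by rwa [e3])
  have l2 : MemLp (fun p => p.2) 2 π := memLp_of_mem_P2 measurable_snd (by rw [hπ2]; exact hμ)
  have hI : Measurable fun p : (EuclideanSpace ℝ (Fin d) × EuclideanSpace ℝ (Fin d)) ×
      EuclideanSpace ℝ (Fin d) => (1 - r) • p.1.1 + r • p.2 := by fun_prop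
  have lI : MemLp (fun p => (1 - r) • p.1.1 + r • p.2) 2 π :=
    (l1.const_smul (1 - r)).add (l2.const_smul r)
  have hmin := h.le ht (map_mem_P2 hI lI)
  have hlow := le_W2_interpolation_sq π (by fun_prop) measurable_snd l1 l2 h₀ hr0.le hr1.le
  have hup := W2_map_sq_le hI (by fun_prop) lI l3
  rw [integral_norm_interpolation_sub_sq l1 l2 l3 r, e3] at hup
  have hK := W2_map_sq_le (by fun_prop) measurable_snd l1 l2
  simp only [e1, hπ2] at hlow hK
  rw [W2_comm ν μ] at hK
  rw [← hπ1, integral_map measurable_fst.aemeasurable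
      (by fun_prop : Measurable _).aestronglyMeasurable] at hγc
  have hsymm : ∫ p, ‖p.2 - p.1.2‖ ^ 2 ∂π < W2 μ ν₁ ^ 2 + δ := by
    refine (integral_congr_ae (ae_of_all _ fun p => ?_)).trans_lt hπc
    exact congrArg (· ^ 2) (norm_sub_rev _ _)
  set K := ∫ p, ‖p.1.1 - p.2‖ ^ 2 ∂π
  set A := ∫ p, ‖p.1.1 - p.1.2‖ ^ 2 ∂π
  set B := ∫ p, ‖p.2 - p.1.2‖ ^ 2 ∂π
  have hδt : t * δ = ε := by rw [hδ]; field_simp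
  have a1 := mul_le_mul_of_nonneg_left hup ht0.le
  have a2 := mul_le_mul_of_nonneg_left hlow (by linarith : 0 ≤ t - 1)
  have a3 := mul_le_mul_of_nonneg_left hγc.le (by nlinarith : 0 ≤ t * (1 - r))
  have a4 := mul_le_mul_of_nonneg_left hsymm.le (by positivity : 0 ≤ t * r)
  have a5 := mul_le_mul_of_nonneg_left hK (by nlinarith : 0 ≤ r * (1 - r))
  have hδt' : t * r * δ = r * ε := by rw [← hδt]; ring
  have hδt'' : t * (1 - r) * δ = (1 - r) * ε := by rw [← hδt]; ring
  -- The term r(1-r)K enters with coefficient t - (t-1) = 1, and the coupling errors add up to tδ =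
  -- ε.
  linarith

/-- Quadratic growth of `F t ν₀ ν₁` at a minimizer. -/
theorem IsMinimizer.add_W2_sq_le {t : ℝ} (ht : 1 < t)
    {ν₀ ν₁ ν μ : Measure (EuclideanSpace ℝ (Fin d))}
    (h : IsMinimizer t ν₀ ν₁ ν) (h₀ : ν₀ ∈ P2 d) (h₁ : ν₁ ∈ P2 d) (hμ : μ ∈ P2 d) :
    t * W2 ν ν₁ ^ 2 - (t - 1) * W2 ν ν₀ ^ 2 + W2 μ ν ^ 2 ≤
      t * W2 μ ν₁ ^ 2 - (t - 1) * W2 μ ν₀ ^ 2 := by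
  have hsq := sq_nonneg (W2 μ ν)
  refine le_of_forall_pos_le_add fun ε hε => ?_
  set D := W2 μ ν ^ 2
  -- This stands in for the limit r → 0: the loss rD is at most ε.
  have hr0 : 0 < ε / (D + ε + 1) := by positivity
  have hr1 : ε / (D + ε + 1) < 1 := by rw [div_lt_one (by positivity)]; linarith
  have hmul : ε / (D + ε + 1) * D ≤ ε := by
    rw [div_mul_eq_mul_div, div_le_iff₀ (by positivity)]
    nlinarith
  have := h.interpolation_le ht h₀ h₁ hμ hr0 hr1
  linarith

/-- With competitor ν₁, x = W₂(ν,ν₁) and w = W₂(ν₀,ν₁), minimality and the triangle inequality give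
x² ≤ 2(t-1)xw; then divide by x. -/
theorem IsMinimizer.W2_le {t : ℝ} (ht : 1 < t) {ν₀ ν₁ ν : Measure (EuclideanSpace ℝ (Fin d))}
    (h : IsMinimizer t ν₀ ν₁ ν) (h₀ : ν₀ ∈ P2 d) (h₁ : ν₁ ∈ P2 d) :
    W2 ν ν₁ ≤ 2 * (t - 1) * W2 ν₀ ν₁ := by
  have hmin := h.le ht h₁
  rw [W2_self h₁, W2_comm ν₁ ν₀] at hmin
  have htri := W2_triangle h.1 h₁ h₀
  rw [W2_comm ν₁ ν₀] at htri
  have hx := W2_nonneg ν ν₁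
  have hw := W2_nonneg ν₀ ν₁
  have hsq : W2 ν ν₀ ^ 2 ≤ (W2 ν ν₁ + W2 ν₀ ν₁) ^ 2 := by
    have := W2_nonneg ν ν₀
    gcongr
  have hsq' := mul_le_mul_of_nonneg_left hsq (by linarith : 0 ≤ t - 1)
  rcases hx.eq_or_lt with hx0 | hx0
  · rw [← hx0]
    exact mul_nonneg (by linarith) hw
  · refine le_of_mul_le_mul_left ?_ hx0
    nlinarith

/-! ### Comparison of the two minimizers -/

theorem abs_sq_sub_sq_le {x y c R : ℝ} (hx0 : 0 ≤ x) (hy0 : 0 ≤ y) (hx : x ≤ R) (hy : y ≤ R)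
    (h1 : x ≤ y + c) (h2 : y ≤ x + c) : |x ^ 2 - y ^ 2| ≤ 2 * R * c := by
  have hxy : |x - y| ≤ c := abs_le.2 ⟨by linarith, by linarith⟩
  have hs : |x + y| ≤ 2 * R := by rw [abs_of_nonneg (by linarith)]; linarith
  rw [sq_sub_sq, abs_mul]
  exact mul_le_mul hs hxy (abs_nonneg _) (by linarith)

/-- The difference of two squared distances to `ρ` and `ρ'`. -/
theorem abs_W2_sq_sub_W2_sq_le {μ ρ ρ' : Measure (EuclideanSpace ℝ (Fin d))} {R : ℝ}
    (hμ : μ ∈ P2 d) (hρ : ρ ∈ P2 d) (hρ' : ρ' ∈ P2 d) (h : W2 μ ρ ≤ R) (h' : W2 μ ρ' ≤ R) :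
    |W2 μ ρ ^ 2 - W2 μ ρ' ^ 2| ≤ 2 * R * W2 ρ ρ' :=
  abs_sq_sub_sq_le (W2_nonneg _ _) (W2_nonneg _ _) h h'
    (by rw [W2_comm ρ ρ']; exact W2_triangle hμ hρ' hρ) (W2_triangle hμ hρ hρ')

/-- R bounds all distances from ν and ν' to the four data: 2MS from the a priori bound, plus at most
S for each of two further triangle inequalities, where S is the sum in `hR`. -/
theorem stability {ν₀ ν₁ ν₀' ν₁' ν ν' : Measure (EuclideanSpace ℝ (Fin d))} {t s M R : ℝ}
    (h₀ : ν₀ ∈ P2 d) (h₁ : ν₁ ∈ P2 d) (h₀' : ν₀' ∈ P2 d) (h₁' : ν₁' ∈ P2 d)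
    (ht : 1 < t) (hs : 1 < s) (htM : t ≤ M) (hsM : s ≤ M)
    (h : IsMinimizer t ν₀ ν₁ ν) (h' : IsMinimizer s ν₀' ν₁' ν')
    (hR : R = (2 * M + 2) * (W2 ν₀ ν₀' + W2 ν₁ ν₁' + W2 ν₀ ν₁)) :
    W2 ν ν' ^ 2 ≤ 4 * M * R * (W2 ν₀ ν₀' + W2 ν₁ ν₁') + 4 * R ^ 2 * |t - s| ^ 2 := by
  have a0 := W2_nonneg ν₀ ν₀'
  have b0 := W2_nonneg ν₁ ν₁'
  have w0 := W2_nonneg ν₀ ν₁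
  have hw' : W2 ν₀' ν₁' ≤ W2 ν₀ ν₀' + W2 ν₁ ν₁' + W2 ν₀ ν₁ := by
    have e1 := W2_triangle h₀' h₀ h₁'
    have e2 := W2_triangle h₀ h₁ h₁'
    rw [W2_comm ν₀' ν₀] at e1
    linarith
  have hM : 1 < M := ht.trans_le htM
  set S := W2 ν₀ ν₀' + W2 ν₁ ν₁' + W2 ν₀ ν₁ with hS
  have hS0 : 0 ≤ S := by positivity
  have hR0 : 0 ≤ R := by rw [hR]; positivity
  have x1 : W2 ν ν₁ ≤ 2 * M * S := (h.W2_le ht h₀ h₁).trans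
    (mul_le_mul (by linarith) (by linarith) w0 (by linarith))
  have y1 : W2 ν' ν₁' ≤ 2 * M * S := (h'.W2_le hs h₀' h₁').trans
    (mul_le_mul (by linarith) hw' (W2_nonneg _ _) (by linarith))
  have x0 : W2 ν ν₀ ≤ 2 * M * S + W2 ν₀ ν₁ := by
    have := W2_triangle h.1 h₁ h₀
    rw [W2_comm ν₁ ν₀] at this
    linarith
  have y0 : W2 ν' ν₀' ≤ 2 * M * S + S := by
    have := W2_triangle h'.1 h₁' h₀'
    rw [W2_comm ν₁' ν₀'] at this
    linarith
  have x1' : W2 ν ν₁' ≤ R := by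
    have := W2_triangle h.1 h₁ h₁'
    linarith
  have x0' : W2 ν ν₀' ≤ R := by
    have := W2_triangle h.1 h₀ h₀'
    linarith
  have y1' : W2 ν' ν₁ ≤ R := by
    have := W2_triangle h'.1 h₁' h₁
    rw [W2_comm ν₁' ν₁] at this
    linarith
  have y0' : W2 ν' ν₀ ≤ R := by
    have := W2_triangle h'.1 h₀' h₀
    rw [W2_comm ν₀' ν₀] at this
    linarith
  replace x1 : W2 ν ν₁ ≤ R := by linarith
  replace y1 : W2 ν' ν₁' ≤ R := by linarith
  replace x0 : W2 ν ν₀ ≤ R := by linarith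
  replace y0 : W2 ν' ν₀' ≤ R := by linarith
  have g := h.add_W2_sq_le ht h₀ h₁ h'.1
  have g' := h'.add_W2_sq_le hs h₀' h₁' h.1
  rw [W2_comm ν' ν] at g
  have d1 := abs_le.1 (abs_W2_sq_sub_W2_sq_le h.1 h₁ h₁' x1 x1')
  have d0 := abs_le.1 (abs_W2_sq_sub_W2_sq_le h.1 h₀ h₀' x0 x0')
  have d1' := abs_le.1 (abs_W2_sq_sub_W2_sq_le h'.1 h₁ h₁' y1' y1)
  have d0' := abs_le.1 (abs_W2_sq_sub_W2_sq_le h'.1 h₀ h₀' y0' y0)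
  have c1 : |W2 ν ν₁' ^ 2 - W2 ν' ν₁' ^ 2| ≤ 2 * R * W2 ν ν' := by
    rw [W2_comm ν ν₁', W2_comm ν' ν₁'] at *
    exact abs_W2_sq_sub_W2_sq_le h₁' h.1 h'.1 x1' y1
  have c0 : |W2 ν ν₀' ^ 2 - W2 ν' ν₀' ^ 2| ≤ 2 * R * W2 ν ν' := by
    rw [W2_comm ν ν₀', W2_comm ν' ν₀'] at *
    exact abs_W2_sq_sub_W2_sq_le h₀' h.1 h'.1 x0' y0
  -- In the sum of `g` and `g'`, writing s = t + (s - t) separates the change of parameter (`hts`)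
  -- from the change of data (`hT`, `hT'`).
  set D := W2 ν ν'
  have hts : (s - t) * ((W2 ν ν₁' ^ 2 - W2 ν' ν₁' ^ 2) - (W2 ν ν₀' ^ 2 - W2 ν' ν₀' ^ 2)) ≤
      |t - s| * (4 * R * D) := by
    refine (le_abs_self _).trans ?_
    rw [abs_mul, abs_sub_comm s t]
    refine mul_le_mul_of_nonneg_left ((abs_sub _ _).trans ?_) (abs_nonneg _)
    linarith
  have hT : t * ((W2 ν' ν₁ ^ 2 - W2 ν' ν₁' ^ 2) + (W2 ν ν₁' ^ 2 - W2 ν ν₁ ^ 2)) ≤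
      M * (4 * R * W2 ν₁ ν₁') :=
    (mul_le_mul_of_nonneg_left (by linarith) (by linarith)).trans
      (mul_le_mul_of_nonneg_right htM (by positivity))
  have hT' : (t - 1) * ((W2 ν' ν₀' ^ 2 - W2 ν' ν₀ ^ 2) + (W2 ν ν₀ ^ 2 - W2 ν ν₀' ^ 2)) ≤
      M * (4 * R * W2 ν₀ ν₀') :=
    (mul_le_mul_of_nonneg_left (by linarith) (by linarith)).trans
      (mul_le_mul_of_nonneg_right (by linarith) (by positivity))
  -- Young: 4RD|t-s| ≤ D² + 4R²|t-s|², so one of the two copies of D² survives.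
  have hyoung := sq_nonneg (D - 2 * R * |t - s|)
  linarith

end MetricExtrapolation

theorem mainTheorem5 :
    ∃ P : MvPolynomial (Fin 4) ℝ,
      (∀ x : Fin 4 → ℝ, (∀ i, 0 ≤ x i) → 0 < MvPolynomial.eval x P) ∧
      ∀ (d : ℕ) (ν₀ ν₁ ν₀' ν₁' νt νs' : Measure (EuclideanSpace ℝ (Fin d))) (t s : ℝ),
        ν₀ ∈ MetricExtrapolation.P2 d → ν₁ ∈ MetricExtrapolation.P2 d →
        ν₀' ∈ MetricExtrapolation.P2 d → ν₁' ∈ MetricExtrapolation.P2 d →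
        1 < t → 1 < s →
        MetricExtrapolation.IsMinimizer t ν₀ ν₁ νt →
        MetricExtrapolation.IsMinimizer s ν₀' ν₁' νs' →
        MetricExtrapolation.W2 νt νs' ^ 2 ≤
          MvPolynomial.eval
              ![max t s, MetricExtrapolation.W2 ν₀ ν₀', MetricExtrapolation.W2 ν₁ ν₁',
                MetricExtrapolation.W2 ν₀ ν₁] P *
            (|t - s| ^ 2 + MetricExtrapolation.W2 ν₀ ν₀' + MetricExtrapolation.W2 ν₁ ν₁') := by
  let R : MvPolynomial (Fin 4) ℝ :=
    (2 * MvPolynomial.X 0 + 2) * (MvPolynomial.X 1 + MvPolynomial.X 2 + MvPolynomial.X 3)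
  -- The sum of the two coefficients in `stability`; the 1 gives strict positivity where R vanishes.
  refine ⟨4 * MvPolynomial.X 0 * R + 4 * R ^ 2 + 1, fun x hx => ?_, ?_⟩
  · have h0 := hx 0
    have h1 := hx 1
    have h2 := hx 2
    have h3 := hx 3
    simp only [R, map_add, map_mul, map_pow, map_one, map_ofNat, MvPolynomial.eval_X]
    positivity
  · intro d ν₀ ν₁ ν₀' ν₁' νt νs' t s h₀ h₁ h₀' h₁' ht hs h h'
    have key := MetricExtrapolation.stability h₀ h₁ h₀' h₁' ht hs (le_max_left t s)
      (le_max_right t s) h h' rfl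
    have a0 := MetricExtrapolation.W2_nonneg ν₀ ν₀'
    have b0 := MetricExtrapolation.W2_nonneg ν₁ ν₁'
    have w0 := MetricExtrapolation.W2_nonneg ν₀ ν₁
    have hM : 0 ≤ max t s := (zero_le_one.trans ht.le).trans (le_max_left t s)
    refine key.trans ?_
    simp only [R, map_add, map_mul, map_pow, map_one, map_ofNat, MvPolynomial.eval_X,
      Matrix.cons_val]
    set Q := (2 * max t s + 2) * (MetricExtrapolation.W2 ν₀ ν₀' + MetricExtrapolation.W2 ν₁ ν₁' +
      MetricExtrapolation.W2 ν₀ ν₁)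
    have hQ : 0 ≤ Q := by positivity
    set a := MetricExtrapolation.W2 ν₀ ν₀'
    set b := MetricExtrapolation.W2 ν₁ ν₁'
    have e1 : 0 ≤ 4 * max t s * Q * |t - s| ^ 2 := by positivity
    have e2 : 0 ≤ 4 * Q ^ 2 * (a + b) := by positivity
    have e3 : 0 ≤ |t - s| ^ 2 := by positivity
    linarith
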